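/- Let $G$ be a finite simple graph with vertex set $\{x_1,\dots,x_n\}$ and at least one edge, let $K$ be a field, and let $I=I(G)$ be the edge ideal of $G$, i.e. the ideal of $R=K[x_1,\dots,x_n]$ generated by all monomials $x_ix_j$ such that $\{x_i,x_j\}$ is an edge of $G$. Then, for every integer $k\ge 1$, $$(I^{k+1}:I)=I^k,$$ where $(I^{k+1}:I)=\{r\in R : rI\subseteq I^{k+1}\}$ is the colon ideal. -/

import Mathlib

/-- The edge ideal of a simple graph `G` over `K`: the ideal of the polynomial ring `K[x_v : v ∈ V]`
generated by the monomials `x_i x_j` with `{i, j}` an edge of `G`. -/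
noncomputable def edgeIdeal (K : Type*) [Field K] {V : Type*} (G : SimpleGraph V) :
    Ideal (MvPolynomial V K) :=
  Ideal.span {p | ∃ i j : V, G.Adj i j ∧ p = MvPolynomial.X i * MvPolynomial.X j}

/-! A polynomial lies in `I^q` iff all its monomials do, and `x^a` does iff the blow-up of `G` with
`a v` copies of each vertex `v` has a matching with `q` edges. Only `(I^(k+1) : I) ⊆ I^k` needs
work; `hasMatching_comap_of_forall_duplicate` reduces it to matchings: some edge of `G` has ends
whose duplication raises the matching number `m` of the blow-up by at most one.

A Tutte–Berge barrier `S` locates that edge. If an edge avoids `S`, duplicating its ends preserves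
all parities, so `S` still bounds matchings. Otherwise `S` is a vertex cover with at most `m`
elements, and for an edge with one end in `S`, one new copy completes `S` to a cover of the enlarged
graph. If all edges lie inside `S`, the blow-up has no edges and a single new vertex covers
everything. -/

section Matching

open scoped Classical
open Finset Function

/-! ### Matchings and the Tutte–Berge formula -/

variable {W : Type*}

/-- `H` has a matching with `q` edges. -/
def HasMatching (H : SimpleGraph W) (q : ℕ) : Prop :=
  ∃ f : Fin q ⊕ Fin q → W, Injective f ∧ ∀ t, H.Adj (f (Sum.inl t)) (f (Sum.inr t))

/-- A set `S` of vertices with a labelling `c` that is constant along the edges avoiding `S`, such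
that every label in `O` occurs an odd number of times outside `S`. -/
structure OddBarrier [Fintype W] (H : SimpleGraph W) {ι : Type*} (S : Finset W) (c : W → ι)
    (O : Finset ι) : Prop where
  label_eq : ∀ x y, H.Adj x y → x ∉ S → y ∉ S → c x = c y
  odd_card : ∀ l ∈ O, Odd #{x | x ∉ S ∧ c x = l}

theorem card_filter_sum {α β : Type*} [Fintype α] [Fintype β] (p : α ⊕ β → Prop)
    [DecidablePred p] :
    #{x | p x} = #{a | p (Sum.inl a)} + #{b | p (Sum.inr b)} := by
  simp only [card_filter, Fintype.sum_sum_type]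

theorem hasMatching_zero (H : SimpleGraph W) : HasMatching H 0 :=
  ⟨fun s => Sum.elim Fin.elim0 Fin.elim0 s, fun s => Sum.elim Fin.elim0 Fin.elim0 s,
    fun t => t.elim0⟩

theorem HasMatching.of_involution [Fintype W] (H : SimpleGraph W) (T : Finset W) (p : W → W)
    (hT : ∀ x ∈ T, p x ∈ T) (hp : ∀ x ∈ T, p (p x) = x) (hadj : ∀ x ∈ T, H.Adj x (p x))
    {q : ℕ} (hq : 2 * q ≤ #T) : HasMatching H q := by
  -- The enumeration singles out one end of each pair `{x, p x}`.
  let e := Fintype.equivFin W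
  set A : Finset W := {x ∈ T | e x < e (p x)} with hA
  have hcard : #T ≤ 2 * #A := by
    have hsub : T ⊆ A ∪ A.image p := by
      intro x hx
      rcases lt_trichotomy (e x) (e (p x)) with h | h | h
      · exact mem_union_left _ (mem_filter.2 ⟨hx, h⟩)
      · exact absurd (e.injective h) (hadj x hx).ne
      · refine mem_union_right _ (mem_image.2 ⟨p x, mem_filter.2 ⟨hT x hx, ?_⟩, hp x hx⟩)
        rwa [hp x hx]
    calc #T ≤ #(A ∪ A.image p) := card_le_card hsub
      _ ≤ #A + #(A.image p) := card_union_le _ _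
      _ ≤ 2 * #A := by have := card_image_le (s := A) (f := p); omega
  obtain ⟨B, hBA, hB⟩ := exists_subset_card_eq (show q ≤ #A by omega)
  let g : Fin q ≃ B := (Fintype.equivFinOfCardEq (by simpa using hB)).symm
  have hgA : ∀ t, (g t : W) ∈ T ∧ e (g t) < e (p (g t)) := fun t =>
    mem_filter.1 (hBA (g t).2)
  refine ⟨Sum.elim (fun t => g t) (fun t => p (g t)), ?_, fun t => hadj _ (hgA t).1⟩
  refine Injective.sumElim (Subtype.val_injective.comp g.injective) ?_ ?_
  · intro s t h
    have := congrArg p h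
    rw [hp _ (hgA s).1, hp _ (hgA t).1] at this
    exact g.injective (Subtype.ext this)
  · intro s t h
    have h1 := (hgA s).2
    have h2 := (hgA t).2
    rw [h, hp _ (hgA t).1] at h1
    exact lt_asymm h1 h2

theorem exists_oddBarrier_of_not_isPerfectMatching.{u} {W : Type u} [Fintype W] (H : SimpleGraph W)
    (h : ¬ ∃ M : H.Subgraph, M.IsPerfectMatching) :
    ∃ (ι : Type u) (S : Finset W) (c : W → ι) (O : Finset ι), OddBarrier H S c O ∧ #S < #O := by
  rw [SimpleGraph.tutte] at h
  push Not at h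
  obtain ⟨u, hu⟩ := h
  let D := ((⊤ : H.Subgraph).deleteVerts u).coe
  have hv : ∀ x, x ∈ ((⊤ : H.Subgraph).deleteVerts u).verts ↔ x ∉ u := by simp
  let c : W → Option D.ConnectedComponent := fun x =>
    if hx : x ∈ u then none else some (D.connectedComponentMk ⟨x, (hv x).2 hx⟩)
  have hc : ∀ (x : W) (hx : x ∉ u), c x = some (D.connectedComponentMk ⟨x, (hv x).2 hx⟩) :=
    fun x hx => dif_neg hx
  refine ⟨_, u.toFinset, c, D.oddComponents.toFinset.map Embedding.some, ⟨?_, ?_⟩, ?_⟩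
  · intro x y hxy hx hy
    simp only [Set.mem_toFinset] at hx hy
    rw [hc x hx, hc y hy]
    congr 1
    refine SimpleGraph.ConnectedComponent.sound (SimpleGraph.Adj.reachable ?_)
    simp [D, hx, hy, hxy]
  · intro l hl
    obtain ⟨K, hK, rfl⟩ := mem_map.1 hl
    have hodd : Odd K.supp.ncard := by simpa using hK
    convert hodd
    rw [← Set.ncard_image_of_injective _ Subtype.val_injective, ← Set.ncard_coe_finset]
    congr 1
    ext x
    simp only [Set.mem_toFinset, coe_filter, mem_univ, true_and, Set.mem_ofPred_eq, Set.mem_image]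
    constructor
    · rintro ⟨hx, hxK⟩
      rw [hc x hx] at hxK
      exact ⟨⟨x, (hv x).2 hx⟩, Option.some_injective _ hxK, rfl⟩
    · rintro ⟨⟨y, hy⟩, hyK, rfl⟩
      have hy' := (hv y).1 hy
      refine ⟨hy', ?_⟩
      rw [hc y hy']
      exact congrArg some hyK
  · rw [card_map]
    rw [SimpleGraph.IsTutteViolator, Set.ncard_eq_toFinset_card', Set.ncard_eq_toFinset_card'] at hu
    convert hu

/-- The upper bound in the Tutte–Berge formula. -/
theorem OddBarrier.card_add_two_mul_le {ι : Type*} [Fintype W] {H : SimpleGraph W} {S : Finset W}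
    {c : W → ι} {O : Finset ι} (hS : OddBarrier H S c O) {q : ℕ} (hq : HasMatching H q) :
    #O + 2 * q ≤ Fintype.card W + #S := by
  obtain ⟨f, hf, hadj⟩ := hq
  have hadj' : ∀ s, H.Adj (f s) (f s.swap) := by
    rintro (t | t)
    · exact hadj t
    · exact (hadj t).symm
  -- An odd class cannot be matched within itself: it contains an unmatched vertex or one whose
  -- partner lies in `S`. These witnesses differ for different labels.
  have key : ∀ l ∈ O, ∃ y : W ⊕ (Fin q ⊕ Fin q),
      (∃ x, y = Sum.inl x ∧ x ∉ Set.range f ∧ c x = l) ∨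
      (∃ s, y = Sum.inr s ∧ f s ∈ S ∧ c (f s.swap) = l) := by
    intro l hl
    by_contra hcon
    push Not at hcon
    have h1 : ∀ x, c x = l → ∃ s, f s = x := fun x hx => by
      by_contra h
      exact ((hcon (Sum.inl x)).1 x rfl h) hx
    have h2 : ∀ s, f s ∈ S → c (f s.swap) ≠ l := fun s hs => (hcon (Sum.inr s)).2 s rfl hs
    have h3 : ∀ s, f s ∉ S → c (f s) = l → f s.swap ∉ S ∧ c (f s.swap) = l := by
      intro s hs hl
      have : f s.swap ∉ S := fun h => by
        have := h2 _ h
        rw [Sum.swap_swap] at this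
        exact this hl
      exact ⟨this, (hS.label_eq _ _ (hadj' s) hs this).symm.trans hl⟩
    have h4 : #{x | x ∉ S ∧ c x = l} =
        #{s : Fin q ⊕ Fin q | f s ∉ S ∧ c (f s) = l} := by
      symm
      refine card_bij (fun s _ => f s) ?_ (fun _ _ _ _ h => hf h) ?_
      · simp
      · intro x hx
        obtain ⟨s, rfl⟩ := h1 x (by simpa using (mem_filter.1 hx).2.2)
        exact ⟨s, by simpa using hx, rfl⟩
    have h5 := hS.odd_card l hl
    rw [h4, card_filter_sum] at h5
    have h6 : ∀ t, (f (Sum.inl t) ∉ S ∧ c (f (Sum.inl t)) = l) ↔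
        (f (Sum.inr t) ∉ S ∧ c (f (Sum.inr t)) = l) := fun t =>
      ⟨fun h => h3 (Sum.inl t) h.1 h.2, fun h => h3 (Sum.inr t) h.1 h.2⟩
    simp only [h6] at h5
    exact (Nat.not_odd_iff_even.2 (Even.add_self _)) h5
  have hle : #O ≤ #(((univ.image f)ᶜ).disjSum ({s | f s ∈ S} : Finset (Fin q ⊕ Fin q))) := by
    rcases O.eq_empty_or_nonempty with rfl | ⟨l₀, hl₀⟩
    · simp
    obtain ⟨y₀, -⟩ := key l₀ hl₀
    have hne : Nonempty (W ⊕ (Fin q ⊕ Fin q)) := ⟨y₀⟩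
    choose! y hy using key
    have hinj : Set.InjOn y O := by
      intro l hl l' hl' h
      rcases hy l hl with ⟨x, hx, -, rfl⟩ | ⟨s, hs, -, rfl⟩ <;>
      rcases hy l' hl' with ⟨x', hx', -, rfl⟩ | ⟨s', hs', -, rfl⟩
      · rw [hx, hx'] at h; rw [Sum.inl_injective h]
      · rw [hx, hs'] at h; cases h
      · rw [hs, hx'] at h; cases h
      · rw [hs, hs'] at h; rw [Sum.inr_injective h]
    refine card_le_card_of_injOn y ?_ hinj
    intro l hl
    rcases hy l hl with ⟨x, hx, hxf, -⟩ | ⟨s, hs, hsS, -⟩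
    · rw [hx]; simpa using hxf
    · rw [hs]; simpa using hsS
  have hcS : #({s | f s ∈ S} : Finset (Fin q ⊕ Fin q)) ≤ #S :=
    card_le_card_of_injOn f (by intro s; simp) hf.injOn
  have hcard : #(univ.image f) = 2 * q := by
    rw [card_image_of_injective _ hf]; simp [two_mul]
  have := card_le_univ (univ.image f)
  rw [card_disjSum, card_compl] at hle
  omega

/-- The lower bound in the Tutte–Berge formula. -/
theorem exists_oddBarrier.{u} {W : Type u} [Fintype W] (H : SimpleGraph W) {m : ℕ}
    (hm : ¬ HasMatching H (m + 1)) (hW : 2 * m + 2 ≤ Fintype.card W) :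
    ∃ (ι : Type u) (S : Finset W) (c : W → ι) (O : Finset ι),
      OddBarrier H S c O ∧ #S + Fintype.card W ≤ #O + 2 * m + 1 := by
  -- With `e` extra vertices adjacent to everything, a perfect matching would leave at least `2m +
  -- 2` old vertices matched among themselves. The total `card W + e` is even.
  set e := Fintype.card W - 2 * m - 2 with he
  let H' : SimpleGraph (W ⊕ Fin e) :=
    { Adj := fun x y => x ≠ y ∧ ∀ a b, x = Sum.inl a → y = Sum.inl b → H.Adj a b
      symm := ⟨fun x y h => ⟨h.1.symm, fun a b ha hb => (h.2 b a hb ha).symm⟩⟩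
      loopless := ⟨fun x h => h.1 rfl⟩ }
  have hno : ¬ ∃ M : H'.Subgraph, M.IsPerfectMatching := by
    rintro ⟨M, hM, hsp⟩
    choose p hp hpu using fun x => hM (hsp x)
    have hpp : ∀ x, p (p x) = x := fun x => (hpu (p x) x (hp x).symm).symm
    let g : W → W := fun x => Sum.elim id (fun _ => x) (p (Sum.inl x))
    have hg : ∀ x y, p (Sum.inl x) = Sum.inl y → g x = y := fun x y h => by simp [g, h]
    refine hm (HasMatching.of_involution H {x | ∃ y, p (Sum.inl x) = Sum.inl y} g ?_ ?_ ?_ ?_)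
    · intro x hx
      obtain ⟨y, hy⟩ := (mem_filter.1 hx).2
      rw [hg x y hy]
      exact mem_filter.2 ⟨mem_univ _, x, by rw [← hy, hpp]⟩
    · intro x hx
      obtain ⟨y, hy⟩ := (mem_filter.1 hx).2
      rw [hg x y hy]
      exact hg y x (by rw [← hy, hpp])
    · intro x hx
      obtain ⟨y, hy⟩ := (mem_filter.1 hx).2
      rw [hg x y hy]
      have := (hp (Sum.inl x)).adj_sub
      rw [hy] at this
      exact this.2 x y rfl rfl
    · have hle : #(({x | ∃ y, p (Sum.inl x) = Sum.inl y} : Finset W)ᶜ) ≤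
          #((univ : Finset (Fin e)).map (Embedding.inr (α := W))) := by
        refine card_le_card_of_injOn (fun x => p (Sum.inl x)) ?_ ?_
        · intro x hx
          rcases h : p (Sum.inl x) with y | z
          · simp [h] at hx
          · simp only [h]
            simp
        · intro x _ y _ h
          have := congrArg p h
          simp only [hpp] at this
          exact Sum.inl_injective this
      rw [card_compl, card_map, card_univ, Fintype.card_fin] at hle
      omega
  obtain ⟨ι, S', c, O, hS', hlt⟩ := exists_oddBarrier_of_not_isPerfectMatching H' hno
  -- A new vertex outside `S'` would force a single label there, hence `S' = ∅` and an odd total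
  -- number of vertices.
  have hr : ∀ z, Sum.inr z ∈ S' := by
    intro z
    by_contra hz
    have hlab : ∀ x, x ∉ S' → c x = c (Sum.inr z) := by
      intro x hx
      by_cases hxz : x = Sum.inr z
      · rw [hxz]
      · exact hS'.label_eq _ _ ⟨hxz, fun a b _ hb => by cases hb⟩ hx hz
    have hO : O ⊆ {c (Sum.inr z)} := by
      intro l hl
      obtain ⟨x, hx⟩ := card_pos.1 (hS'.odd_card l hl).pos
      simp only [mem_filter, mem_univ, true_and] at hx
      rw [mem_singleton, ← hx.2, hlab x hx.1]
    have hO1 := card_le_card hO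
    rw [card_singleton] at hO1
    have hS0 : S' = ∅ := card_eq_zero.1 (by omega)
    obtain ⟨l, hl⟩ := card_pos.1 (show 0 < #O by omega)
    have hodd := hS'.odd_card l hl
    obtain rfl := mem_singleton.1 (hO hl)
    have hall : ∀ x, x ∉ S' ∧ c x = c (Sum.inr z) := fun x =>
      ⟨by simp [hS0], hlab x (by simp [hS0])⟩
    have hodd' : Odd (Fintype.card (W ⊕ Fin e)) := by
      rw [← card_univ]
      convert hodd using 2
      ext x
      simpa only [mem_univ, mem_filter, true_and, true_iff] using hall x
    rw [Fintype.card_sum, Fintype.card_fin] at hodd'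
    obtain ⟨r, hr⟩ := hodd'
    omega
  have hSe : #(S'.toLeft) + e = #S' := by
    rw [← card_toLeft_add_card_toRight (u := S')]
    congr 1
    have : S'.toRight = univ := by ext z; simp [hr]
    rw [this, card_univ, Fintype.card_fin]
  refine ⟨ι, S'.toLeft, c ∘ Sum.inl, O, ⟨?_, ?_⟩, by omega⟩
  · intro x y hxy hx hy
    refine hS'.label_eq _ _ ⟨fun h => hxy.ne (Sum.inl_injective h), ?_⟩ (by simpa using hx)
      (by simpa using hy)
    intro a b ha hb
    rwa [← Sum.inl_injective ha, ← Sum.inl_injective hb]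
  · intro l hl
    convert hS'.odd_card l hl using 1
    refine card_bij (fun x _ => Sum.inl x) ?_ (fun _ _ _ _ h => Sum.inl_injective h) ?_
    · simp
    · rintro (x | z) hx
      · exact ⟨x, by simpa using hx, rfl⟩
      · simp [hr] at hx

/-! ### Duplicating the ends of an edge -/

theorem HasMatching.le_card_of_cover {H : SimpleGraph W} {q : ℕ} (hq : HasMatching H q)
    (C : Finset W) (hC : ∀ x y, H.Adj x y → x ∈ C ∨ y ∈ C) : q ≤ #C := by
  obtain ⟨f, hf, hadj⟩ := hq
  have : ∀ t, ∃ s, (s = Sum.inl t ∨ s = Sum.inr t) ∧ f s ∈ C := fun t =>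
    (hC _ _ (hadj t)).elim (fun h => ⟨_, Or.inl rfl, h⟩) (fun h => ⟨_, Or.inr rfl, h⟩)
  choose g hg hgC using this
  have hginj : Injective g := by
    intro s t h
    rcases hg s with h1 | h1 <;> rcases hg t with h2 | h2 <;> rw [h1, h2] at h <;> cases h <;> rfl
  simpa using card_le_card_of_injOn (s := univ) (fun t => f (g t)) (fun t _ => hgC t)
    (hf.comp hginj).injOn

theorem HasMatching.two_mul_le_card {H : SimpleGraph W} {q : ℕ} (hq : HasMatching H q)
    (C : Finset W) (hC : ∀ x y, H.Adj x y → x ∈ C ∧ y ∈ C) : 2 * q ≤ #C := by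
  obtain ⟨f, hf, hadj⟩ := hq
  have := card_le_card_of_injOn (s := univ) (t := C) f
    (by rintro (t | t) -; exacts [(hC _ _ (hadj t)).1, (hC _ _ (hadj t)).2]) hf.injOn
  simpa [two_mul] using this

/-- Duplicating the ends of an edge `v w` adds at most one edge to a maximum matching when the edge
avoids an odd barrier. -/
theorem OddBarrier.card_add_two_mul_le_of_duplicate {ι : Type*} [Fintype W] {H : SimpleGraph W}
    {S : Finset W} {c : W → ι} {O : Finset ι} (hS : OddBarrier H S c O) {v w : W}
    (hvw : H.Adj v w) (hv : v ∉ S) (hw : w ∉ S) {q : ℕ}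
    (hq : HasMatching (H.comap (Sum.elim id fun b : Bool => cond b v w)) q) :
    #O + 2 * q ≤ Fintype.card W + 2 + #S := by
  set ρ : W ⊕ Bool → W := Sum.elim id fun b : Bool => cond b v w with hρ
  have hbar : OddBarrier (H.comap ρ) (S.disjSum (∅ : Finset Bool)) (c ∘ ρ) O := by
    have hmem : ∀ x, x ∉ S.disjSum (∅ : Finset Bool) ↔ ρ x ∉ S := by
      rintro (x | (b | b)) <;> simp [hρ, hv, hw]
    refine ⟨fun x y hxy hx hy => hS.label_eq _ _ hxy ((hmem x).1 hx) ((hmem y).1 hy), ?_⟩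
    intro l hl
    simp only [hmem]
    rw [card_filter_sum]
    -- Both copies carry the same label, so each class gains 0 or 2 vertices.
    refine Odd.add_even (hS.odd_card l hl) ?_
    have hc := hS.label_eq _ _ hvw hv hw
    by_cases h : c w = l
    · rw [filter_true_of_mem]
      · simp
      · rintro (b | b) - <;> simp [hρ, hv, hw, hc, h]
    · rw [filter_false_of_mem]
      · simp
      · rintro (b | b) - <;> simp [hρ, hv, hw, hc, h]
  simpa using hbar.card_add_two_mul_le hq

/-- If, for every edge `i j` of `G`, the blow-up of `G` along `π` with one more copy of `i` and of
`j` has a matching with `k + 1` edges, then the blow-up itself has a matching with `k` edges. -/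
theorem hasMatching_comap_of_forall_duplicate {V W : Type*} [Fintype W] {G : SimpleGraph V}
    (hG : G.edgeSet.Nonempty) (π : W → V) {k : ℕ}
    (h : ∀ i j, G.Adj i j →
      HasMatching (G.comap (Sum.elim π fun b : Bool => cond b i j)) (k + 1)) :
    HasMatching (G.comap π) k := by
  by_contra hk
  obtain ⟨m, hmk, hm, hm1⟩ :
      ∃ m < k, HasMatching (G.comap π) m ∧ ¬ HasMatching (G.comap π) (m + 1) := by
    by_contra! hcon
    have : ∀ m ≤ k, HasMatching (G.comap π) m := by
      intro m
      induction m with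
      | zero => exact fun _ => hasMatching_zero _
      | succ m ih => exact fun hm => hcon m hm (ih (by omega))
    exact hk (this k le_rfl)
  obtain ⟨i, j, hij⟩ : ∃ i j, G.Adj i j := by
    obtain ⟨e, he⟩ := hG
    induction e using Sym2.ind with
    | _ i j => exact ⟨i, j, he⟩
  by_cases hW : Fintype.card W ≤ 2 * m + 1
  · have := (h i j hij).two_mul_le_card univ (by simp)
    simp only [card_univ, Fintype.card_sum, Fintype.card_bool] at this
    omega
  obtain ⟨ι, S, c, O, hS, hcard⟩ := exists_oddBarrier (G.comap π) hm1 (by omega)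
  by_cases hout : ∃ v w, G.Adj (π v) (π w) ∧ v ∉ S ∧ w ∉ S
  · obtain ⟨v, w, hvw, hv, hw⟩ := hout
    have hq : HasMatching ((G.comap π).comap (Sum.elim id fun b : Bool => cond b v w)) (k + 1) := by
      rw [SimpleGraph.comap_comap]
      convert h _ _ hvw using 2
      ext (x | (b | b)) <;> rfl
    have := hS.card_add_two_mul_le_of_duplicate hvw hv hw hq
    omega
  push Not at hout
  -- Each odd class has a vertex outside `S`; with `hcard` this gives `2 * #S ≤ 2 * m + 1`.
  have hOS : #O ≤ #Sᶜ := by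
    have : ∀ l ∈ O, ∃ x, x ∉ S ∧ c x = l := fun l hl => by
      obtain ⟨x, hx⟩ := card_pos.1 (hS.odd_card l hl).pos
      exact ⟨x, by simpa using hx⟩
    rcases O.eq_empty_or_nonempty with rfl | ⟨l₀, hl₀⟩
    · simp
    obtain ⟨x₀, -⟩ := this l₀ hl₀
    have hne : Nonempty W := ⟨x₀⟩
    choose! x hx hcx using this
    refine card_le_card_of_injOn x (fun l hl => by simpa using hx l hl) ?_
    intro l hl l' hl' hll
    rw [← hcx l hl, ← hcx l' hl', hll]
  have hSm : #S ≤ m := by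
    rw [card_compl] at hOS
    have := card_le_univ S
    omega
  by_cases hcross : ∃ v w, G.Adj (π v) (π w) ∧ v ∈ S ∧ w ∉ S
  · obtain ⟨v, w, hvw, hv, hw⟩ := hcross
    -- All neighbours of `w` in the blow-up lie in `S`, so `S` and the new copy `true` of `v` form a
    -- cover, whence `k + 1 ≤ m + 1`.
    have := (h _ _ hvw).le_card_of_cover (S.disjSum {true}) (by
      have hN : ∀ x, G.Adj (π w) (π x) → x ∈ S := fun x hx => by
        by_contra hxS
        exact hxS (hout w x hx hw)
      rintro (x | (b | b)) (y | (b' | b')) hxy <;>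
        simp only [SimpleGraph.comap_adj, Sum.elim_inl, Sum.elim_inr, cond_true, cond_false,
          inl_mem_disjSum, inr_mem_disjSum, mem_singleton] at hxy ⊢ <;> try simp
      · by_contra! hcon
        exact hcon.2 (hout x y hxy hcon.1)
      · exact hN x hxy.symm
      · exact hN y hxy
      · exact hxy.ne rfl)
    rw [card_disjSum, card_singleton] at this
    omega
  push Not at hcross
  have hboth : ∀ v w, G.Adj (π v) (π w) → v ∈ S ∧ w ∈ S := by
    intro v w hvw
    by_cases hv : v ∈ S
    · exact ⟨hv, hcross v w hvw hv⟩
    · exact absurd (hcross w v hvw.symm (hout v w hvw hv)) hv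
  -- Now `2 * m ≤ #S ≤ m`, so `m = 0` and `S` is empty.
  have hm0 := hm.two_mul_le_card S hboth
  have hS0 : S = ∅ := card_eq_zero.1 (by omega)
  have hempty : ∀ v w, ¬ G.Adj (π v) (π w) := fun v w hvw => by
    simpa [hS0] using hboth v w hvw
  -- As the new copy of `i` has no neighbour in the blow-up, the copy `false` of `j` alone covers
  -- all edges.
  obtain ⟨i, j, hij, hj⟩ : ∃ i j, G.Adj i j ∧ ∀ w, ¬ G.Adj (π w) i := by
    by_cases htouch : ∃ w i, G.Adj (π w) i
    · obtain ⟨w, i, hwi⟩ := htouch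
      exact ⟨π w, i, hwi, fun x => hempty x w⟩
    · push Not at htouch
      exact ⟨i, j, hij, fun w => htouch w i⟩
  have := (h i j hij).le_card_of_cover {Sum.inr false} (by
    rintro (x | (b | b)) (y | (b' | b')) hxy <;>
      simp only [SimpleGraph.comap_adj, Sum.elim_inl, Sum.elim_inr, cond_true, cond_false] at hxy <;>
      try simp
    · exact hempty x y hxy
    · exact hj x hxy
    · exact hj y hxy.symm
    · exact hxy.ne rfl)
  rw [card_singleton] at this
  omega

end Matching

/-! ### Blow-ups and monomials in powers of the edge ideal -/

section Blowup

open scoped Classical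
open Finset Function

/-- The lift is built fibre by fibre, which turns divisibility of monomials into distinctness of the
chosen copies. -/
theorem exists_injective_lift_iff {T V W : Type*} [Fintype T] [Fintype W] (f : T → V) (π : W → V) :
    (∃ g : T → W, Injective g ∧ ∀ t, π (g t) = f t) ↔
      ∀ v, #{t | f t = v} ≤ #{w | π w = v} := by
  constructor
  · rintro ⟨g, hg, hgf⟩ v
    exact card_le_card_of_injOn g (by intro t; simp [hgf]) hg.injOn
  · intro h
    have : ∀ v, Nonempty ({t // f t = v} ↪ {w // π w = v}) := fun v => by
      refine Embedding.nonempty_of_card_le ?_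
      simpa [Fintype.card_subtype] using h v
    have e := fun v => (this v).some
    refine ⟨fun t => e (f t) ⟨t, rfl⟩, ?_, fun t => (e (f t) ⟨t, rfl⟩).2⟩
    intro s t hst
    have hfst : f s = f t := by
      rw [← (e (f s) ⟨s, rfl⟩).2, ← (e (f t) ⟨t, rfl⟩).2]
      exact congrArg π hst
    have : ∀ (v : V) (hs : f s = v), (e (f s) ⟨s, rfl⟩ : W) = e v ⟨s, hs⟩ := by
      rintro v rfl; rfl
    have h2 := (e (f t)).injective (Subtype.ext ((this _ hfst).symm.trans hst))
    simpa using h2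

theorem sum_single_apply_eq_card {T V : Type*} [Fintype T] (f : T → V) (v : V) :
    (∑ t, Finsupp.single (f t) 1 : V →₀ ℕ) v = #{t | f t = v} := by
  rw [Finsupp.finsetSum_apply]
  simp [Finsupp.single_apply]

theorem hasMatching_comap_iff {V W : Type*} [Fintype W] (G : SimpleGraph V) (π : W → V) (q : ℕ) :
    HasMatching (G.comap π) q ↔
      ∃ f : Fin q ⊕ Fin q → V, (∀ t, G.Adj (f (Sum.inl t)) (f (Sum.inr t))) ∧
        ∑ s, Finsupp.single (f s) 1 ≤ ∑ w, Finsupp.single (π w) 1 := by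
  have hle : ∀ f : Fin q ⊕ Fin q → V,
      (∑ s, Finsupp.single (f s) 1 : V →₀ ℕ) ≤ ∑ w, Finsupp.single (π w) 1 ↔
        ∃ g : Fin q ⊕ Fin q → W, Injective g ∧ ∀ t, π (g t) = f t := fun f => by
    rw [exists_injective_lift_iff]
    exact forall_congr' fun v => by rw [sum_single_apply_eq_card, sum_single_apply_eq_card]
  simp only [hle]
  constructor
  · rintro ⟨g, hg, hadj⟩
    exact ⟨π ∘ g, hadj, g, hg, fun _ => rfl⟩
  · rintro ⟨f, hadj, g, hg, hgf⟩
    exact ⟨g, hg, fun t => by simpa [hgf] using hadj t⟩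

/-- The exponents of the products of `q` edges of `G`. -/
def edgeExponents {V : Type*} (G : SimpleGraph V) (q : ℕ) : Set (V →₀ ℕ) :=
  {s | ∃ f : Fin q ⊕ Fin q → V, (∀ t, G.Adj (f (Sum.inl t)) (f (Sum.inr t))) ∧
    s = ∑ s, Finsupp.single (f s) 1}

theorem edgeExponents_succ {V : Type*} (G : SimpleGraph V) (q : ℕ) :
    edgeExponents G (q + 1) =
      {s | ∃ s' ∈ edgeExponents G q, ∃ i j, G.Adj i j ∧
        s = s' + (Finsupp.single i 1 + Finsupp.single j 1)} := by
  ext s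
  simp only [edgeExponents, Set.mem_ofPred_eq, Fintype.sum_sum_type]
  constructor
  · rintro ⟨f, hf, rfl⟩
    refine ⟨_, ⟨Sum.elim (fun t => f (Sum.inl t.succ)) (fun t => f (Sum.inr t.succ)),
      fun t => hf t.succ, rfl⟩, _, _, hf 0, ?_⟩
    simp only [Fin.sum_univ_succ, Sum.elim_inl, Sum.elim_inr]
    abel
  · rintro ⟨_, ⟨f, hf, rfl⟩, i, j, hij, rfl⟩
    refine ⟨Sum.elim (Fin.cons i fun t => f (Sum.inl t)) (Fin.cons j fun t => f (Sum.inr t)),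
      Fin.cases hij fun t => by simpa using hf t, ?_⟩
    simp only [Fin.sum_univ_succ, Sum.elim_inl, Sum.elim_inr, Fin.cons_zero, Fin.cons_succ]
    abel

theorem edgeIdeal_pow_eq_span (K : Type*) [Field K] {V : Type*} (G : SimpleGraph V) (q : ℕ) :
    edgeIdeal K G ^ q =
      Ideal.span ((fun s => MvPolynomial.monomial s (1 : K)) '' edgeExponents G q) := by
  induction q with
  | zero =>
    have : edgeExponents G 0 = {0} := by
      ext s; simp [edgeExponents]
    rw [this, Set.image_singleton, pow_zero]
    simp
  | succ q ih =>
    rw [pow_succ, ih, edgeIdeal, Ideal.span_mul_span', edgeExponents_succ]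
    congr 1
    ext p
    simp only [Set.mem_mul, Set.mem_image, Set.mem_ofPred_eq]
    constructor
    · rintro ⟨_, ⟨s, hs, rfl⟩, _, ⟨i, j, hij, rfl⟩, rfl⟩
      refine ⟨_, ⟨s, hs, i, j, hij, rfl⟩, ?_⟩
      simp [MvPolynomial.X, MvPolynomial.monomial_mul]
    · rintro ⟨_, ⟨s, hs, i, j, hij, rfl⟩, rfl⟩
      refine ⟨_, ⟨s, hs, rfl⟩, _, ⟨i, j, hij, rfl⟩, ?_⟩
      simp [MvPolynomial.X, MvPolynomial.monomial_mul]

theorem mem_edgeIdeal_pow_iff {K : Type*} [Field K] {V : Type*} (G : SimpleGraph V) (q : ℕ)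
    (p : MvPolynomial V K) :
    p ∈ edgeIdeal K G ^ q ↔ ∀ a ∈ p.support,
      ∃ f : Fin q ⊕ Fin q → V, (∀ t, G.Adj (f (Sum.inl t)) (f (Sum.inr t))) ∧
        ∑ s, Finsupp.single (f s) 1 ≤ a := by
  rw [edgeIdeal_pow_eq_span, MvPolynomial.mem_ideal_span_monomial_image]
  refine forall₂_congr fun a _ => ⟨?_, ?_⟩
  · rintro ⟨_, ⟨f, hf, rfl⟩, hle⟩
    exact ⟨f, hf, hle⟩
  · rintro ⟨f, hf, hle⟩
    exact ⟨_, ⟨f, hf, rfl⟩, hle⟩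

end Blowup

/-! ### The colon ideal -/

theorem lemma2p7 {K : Type*} [Field K] {V : Type*} [Finite V] (G : SimpleGraph V)
    (hG : G.edgeSet.Nonempty) (k : ℕ) (hk : 1 ≤ k) :
    (edgeIdeal K G ^ (k + 1)).colon (edgeIdeal K G : Set (MvPolynomial V K)) =
      edgeIdeal K G ^ k := by
  classical
  cases nonempty_fintype V
  apply le_antisymm
  · intro r hr
    rw [Submodule.mem_colon] at hr
    rw [mem_edgeIdeal_pow_iff]
    intro a ha
    have hsum : ∑ w : (Σ v, Fin (a v)), Finsupp.single w.1 1 = a := by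
      ext v
      simp [Fintype.sum_sigma]
    suffices h : HasMatching (G.comap (Sigma.fst : (Σ v, Fin (a v)) → V)) k by
      rwa [hasMatching_comap_iff, hsum] at h
    refine hasMatching_comap_of_forall_duplicate hG _ fun i j hij => ?_
    rw [hasMatching_comap_iff]
    have hmem := hr _ (Ideal.subset_span ⟨i, j, hij, rfl⟩)
    rw [smul_eq_mul, mem_edgeIdeal_pow_iff] at hmem
    -- Multiplication by `X i * X j` only shifts exponents, so nothing cancels and the shifted `a`
    -- stays in the support.
    convert hmem (a + Finsupp.single i 1 + Finsupp.single j 1) ?_ using 4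
    · simp [Fintype.sum_sum_type, hsum, add_assoc]
    · rw [MvPolynomial.mem_support_iff, ← mul_assoc, MvPolynomial.coeff_mul_X,
        MvPolynomial.coeff_mul_X]
      exact MvPolynomial.mem_support_iff.1 ha
  · intro r hr
    rw [Submodule.mem_colon]
    intro s hs
    rw [pow_succ]
    exact Ideal.mul_mem_mul hr hs
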